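/- Let $k$ be a field that is complete with respect to a non-trivial non-archimedean absolute value $|\cdot|$, and let $A$ be a strictly $k$-affinoid algebra, i.e. a commutative $k$-Banach algebra admitting a surjective homomorphism of $k$-algebras $k\langle T_1,\dots,T_n\rangle\to A$ from a Tate algebra for some $n\ge 0$. Let $A^\circ$ be the set of power-bounded elements of $A$. Let $\mathrm{Spa}(A,A^\circ)$ be the set of equivalence classes of continuous valuations $x$ on $A$ with $|f(x)|\le 1$ for all $f\in A^\circ$, with the topology generated by the sets $\{x : |f(x)|\le |g(x)|\ne 0\}$ for $f,g\in A$. Let $\mathcal M(A)$ be the set of bounded multiplicative seminorms $p:A\to\mathbb R_{\ge 0}$ with $p(1)=1$, with the weakest topology making all evaluations $p\mapsto p(f)$, $f\in A$, continuous. A point $\eta$ of a space is a generization of $x$ if $x\in\overline{\{\eta\}}$; it is a maximal generization of $x$ if moreover $\eta$ has no generization other than itself. Then: 1. Every $x\in \mathrm{Spa}(A,A^\circ)$ has a unique maximal generization $\eta_x$, and $\eta_x$ has rank $1$. 2. For every point $\eta\in\mathrm{Spa}(A,A^\circ)$ of rank $1$ there is a unique $p\in\mathcal M(A)$ that is equivalent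 to $\eta$ as a valuation; every $p\in\mathcal M(A)$ is normalized, i.e. $p(a)=|a|$ for all $a\in k$. 3. The map $q:\mathrm{Spa}(A,A^\circ)\to\mathcal M(A)$ sending $x$ to the unique element of $\mathcal M(A)$ equivalent to $\eta_x$ is a continuous surjection. 4. The map $q$ makes $\mathcal M(A)$ the universal $T_1$-quotient of $\mathrm{Spa}(A,A^\circ)$: the space $\mathcal M(A)$ is $T_1$ and carries the quotient topology of $q$, and for every $T_1$-space $Y$ and every continuous map $f:\mathrm{Spa}(A,A^\circ)\to Y$ there is a unique continuous map $g:\mathcal M(A)\to Y$ such that $f=g\circ q$. -/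

import Mathlib

open Filter Topology

noncomputable section

/-- The Tate algebra `k⟨T₁, …, Tₙ⟩`: formal power series over `k` whose coefficients tend to
zero. -/
def tateAlgebra (k : Type*) [NontriviallyNormedField k] [IsUltrametricDist k] (n : ℕ) :
    Subalgebra k (MvPowerSeries (Fin n) k) where
  __ := MvPowerSeries.IsRestricted.subring (fun _ : Fin n => (1 : ℝ))
  algebraMap_mem' a := MvPowerSeries.isRestricted_C (fun _ : Fin n => (1 : ℝ)) a

/-- A `k`-Banach algebra `A` is strictly `k`-affinoid if some Tate algebra over `k` surjects
onto it by a homomorphism of `k`-algebras. -/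
def IsStrictlyAffinoid (k A : Type*) [NontriviallyNormedField k] [IsUltrametricDist k]
    [NormedCommRing A] [NormedAlgebra k A] [CompleteSpace A] : Prop :=
  ∃ (n : ℕ) (π : tateAlgebra k n →ₐ[k] A), Function.Surjective π

section Adic

/-- Boundedness of a subset of a topological ring. -/
def IsBoundedSubset {A : Type*} [CommRing A] [TopologicalSpace A] (S : Set A) : Prop :=
  ∀ U ∈ 𝓝 (0 : A), ∃ V ∈ 𝓝 (0 : A), ∀ a ∈ V, ∀ s ∈ S, a * s ∈ U

/-- The set `A°` of power-bounded elements of a topological ring `A`. -/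
def powerBounded (A : Type*) [CommRing A] [TopologicalSpace A] : Set A :=
  {a | IsBoundedSubset (Set.range fun n : ℕ => a ^ n)}

/-- The adic spectrum `Spa(A, A⁺)`: equivalence classes of continuous valuations of `A` that are
at most `1` on `A⁺`. An equivalence class of valuations is given by its valuative relation
(`f ≤ᵥ g` means `|f| ≤ |g|`), and `ValuativeRel.valuation A` is the representative of the class
whose values generate the value group. -/
@[ext]
structure Spa (A : Type*) [CommRing A] [TopologicalSpace A] (Aplus : Set A) where
  /-- the equivalence class of valuations -/
  rel : ValuativeRel A
  isOpen_lt : ∀ γ : ValuativeRel.ValueGroupWithZero A, γ ≠ 0 →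
    IsOpen {f : A | ValuativeRel.valuation A f < γ}
  le_one : ∀ f ∈ Aplus, ValuativeRel.valuation A f ≤ 1

variable {A : Type*} [CommRing A] [TopologicalSpace A] {Aplus : Set A}

/-- The value group of a point of the adic spectrum, together with zero. -/
abbrev Spa.ValueGroup₀ (x : Spa A Aplus) : Type _ :=
  @ValuativeRel.ValueGroupWithZero A _ x.rel

/-- The valuation, with values in its value group, that represents a point. -/
def Spa.val (x : Spa A Aplus) : Valuation A x.ValueGroup₀ :=
  @ValuativeRel.valuation A _ x.rel

/-- The topology of the adic spectrum, generated by the sets `{x | |f(x)| ≤ |g(x)| ≠ 0}`. -/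
instance Spa.instTopologicalSpace : TopologicalSpace (Spa A Aplus) :=
  TopologicalSpace.generateFrom
    {U | ∃ f g : A, U = {x : Spa A Aplus | x.val f ≤ x.val g ∧ x.val g ≠ 0}}

/-- The rank of a point: the number of convex subgroups, other than the trivial subgroup, of
its value group. -/
def Spa.rank (x : Spa A Aplus) : ℕ∞ :=
  Set.encard {H : Subgroup (x.ValueGroup₀)ˣ |
    H ≠ ⊥ ∧ ∀ g, ∀ h ∈ H, h ≤ g → g ≤ 1 → g ∈ H}

end Adic

/-- `η` is a maximal generization of `x`: it is a generization of `x`, and it has no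
generization other than itself. (Here `η ⤳ x` means that `x` lies in the closure of `{η}`.) -/
def IsMaximalGenerization {X : Type*} [TopologicalSpace X] (η x : X) : Prop :=
  η ⤳ x ∧ ∀ y : X, y ⤳ η → y = η

section Berkovich

/-- The Berkovich spectrum `ℳ(A)` of a normed ring: bounded multiplicative seminorms `p` on `A`
(with `p 1 = 1`, which is part of `MulRingSeminorm`). -/
structure BerkovichSpectrum (A : Type*) [NormedCommRing A] where
  seminorm : MulRingSeminorm A
  bounded : ∃ C : ℝ, 0 < C ∧ ∀ f : A, seminorm f ≤ C * ‖f‖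

variable {A : Type*} [NormedCommRing A]

/-- The weakest topology for which all evaluations `p ↦ p f` are continuous. -/
instance BerkovichSpectrum.instTopologicalSpace : TopologicalSpace (BerkovichSpectrum A) :=
  TopologicalSpace.induced (fun p (f : A) => p.seminorm f) inferInstance

/-- The seminorm `p` represents the point `x` of the adic spectrum, that is, `p` and the
valuation of `x` are equivalent. -/
def BerkovichSpectrum.Represents {Aplus : Set A} (p : BerkovichSpectrum A)
    (x : Spa A Aplus) : Prop :=
  ∀ f g : A, p.seminorm f ≤ p.seminorm g ↔ x.val f ≤ x.val g

end Berkovich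

end

/-! The scalars form a ruler inside the value group of every point `x`. The unit balls of `k` and of
`A` are power-bounded and `x` is continuous, so `x` restricts to the absolute value of `k`, every
`f` is dominated by a scalar, and every nonzero value dominates a nonzero scalar. Comparing powers
of `f` with scalars then measures `f` by a real number, its `gauge`. Powers are needed because `k`
may be discretely valued, while the roots of its absolute values are always dense in the positive
reals (`exists_pow_eq_norm_between`).

The gauge is a bounded multiplicative seminorm with the same support as `x`; this defines `q`
(`toBerkovich`). Conversely, a bounded multiplicative seminorm is a continuous valuation (`toSpa`).
Comparisons with nonzero scalars are open and closed under generization, so the gauge is constant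
along specializations and continuous in `x`. It follows that `toSpa (q x)` is the only maximal
generization of `x`. Rank one means that the value group is archimedean, which is when the gauge
loses nothing.

The quotient property is topological: the adic spectrum is compact, by an explicit limit of each
ultrafilter, and the Berkovich spectrum is Hausdorff, so `q` is closed. A continuous map to a
`T₁`-space identifies `x` with its generization `toSpa (q x)`, hence factors. -/

noncomputable section

/-! ### Measuring a valuation by scalars -/

namespace Valuation

variable {k A Γ₀ : Type*} [NontriviallyNormedField k] [CommRing A] [Algebra k A]
  [LinearOrderedCommGroupWithZero Γ₀]

/-- The real number `r` bounds `f` from above: a power of `f` is dominated by a scalar whose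
absolute value is the same power of `r`. -/
def upperBoundSet (k : Type*) [NontriviallyNormedField k] [Algebra k A] (v : Valuation A Γ₀)
    (f : A) : Set ℝ :=
  {r | 0 < r ∧ ∃ n : ℕ, n ≠ 0 ∧ ∃ c : k, r ^ n = ‖c‖ ∧ v f ^ n ≤ v (algebraMap k A c)}

/-- The real-valued function on `A` obtained by comparing powers of elements with scalars. -/
def gauge (k : Type*) [NontriviallyNormedField k] [Algebra k A] (v : Valuation A Γ₀)
    (f : A) : ℝ :=
  sInf (upperBoundSet k v f)

/-- The valuation `v` extends the absolute value of `k`, and every element is dominated by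
a scalar. -/
structure IsScalarBounded (k : Type*) [NontriviallyNormedField k] [Algebra k A]
    (v : Valuation A Γ₀) : Prop where
  le_iff : ∀ c d : k, v (algebraMap k A c) ≤ v (algebraMap k A d) ↔ ‖c‖ ≤ ‖d‖
  exists_le : ∀ f : A, ∃ c : k, v f ≤ v (algebraMap k A c)

variable (k) in
/-- The radicals of the absolute values of scalars are dense in the positive reals. -/
theorem _root_.exists_pow_eq_norm_between {s t : ℝ} (hs : 0 ≤ s) (hst : s < t) :
    ∃ r, s < r ∧ r < t ∧ ∃ n : ℕ, n ≠ 0 ∧ ∃ c : k, c ≠ 0 ∧ r ^ n = ‖c‖ := by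
  obtain ⟨u, hu⟩ := NormedField.exists_one_lt_norm k
  wlog hs' : 0 < s generalizing s
  · obtain ⟨r, h1, h2⟩ := this (s := (s + t) / 2) (by linarith) (by linarith) (by linarith)
    exact ⟨r, by linarith, h2⟩
  have hu0 : 0 < ‖u‖ := by linarith
  have hlu : 0 < Real.log ‖u‖ := Real.log_pos hu
  -- Take `q` between the logarithms of `s` and `t` to base `‖u‖`; then `r = ‖u‖ ^ q`, and its power
  -- with exponent `q.den` is `‖u ^ q.num‖`.
  obtain ⟨q, hq1, hq2⟩ := exists_rat_btwn
    (div_lt_div_of_pos_right (Real.log_lt_log hs' hst) hlu)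
  rw [div_lt_iff₀ hlu] at hq1
  rw [lt_div_iff₀ hlu] at hq2
  refine ⟨Real.exp (q * Real.log ‖u‖), (Real.log_lt_iff_lt_exp hs').1 hq1,
    (Real.lt_log_iff_exp_lt (hs'.trans hst)).1 hq2, q.den, q.den_nz, u ^ q.num,
    zpow_ne_zero _ (norm_pos_iff.1 hu0), ?_⟩
  rw [← Real.exp_nat_mul, norm_zpow, ← mul_assoc]
  have h : ((q.den : ℝ) * (q : ℝ)) = (q.num : ℝ) := by
    exact_mod_cast Rat.den_mul_eq_num q
  rw [h, ← Real.rpow_intCast, Real.rpow_def_of_pos hu0, mul_comm]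

theorem gauge_nonneg (v : Valuation A Γ₀) (f : A) : 0 ≤ v.gauge k f :=
  Real.sInf_nonneg fun _ hr => hr.1.le

theorem gauge_le {v : Valuation A Γ₀} {f : A} {r : ℝ} (hr : 0 < r) {n : ℕ} (hn : n ≠ 0) {c : k}
    (hc : r ^ n = ‖c‖) (h : v f ^ n ≤ v (algebraMap k A c)) : v.gauge k f ≤ r :=
  csInf_le ⟨0, fun _ hs => hs.1.le⟩ ⟨hr, n, hn, c, hc, h⟩

namespace IsScalarBounded

variable {v : Valuation A Γ₀}

theorem ne_zero (hv : v.IsScalarBounded k) {c : k} (hc : c ≠ 0) : v (algebraMap k A c) ≠ 0 := by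
  intro h
  have := (hv.le_iff c 0).1 (by simp [h])
  simp_all

theorem lt_iff (hv : v.IsScalarBounded k) (c d : k) :
    v (algebraMap k A c) < v (algebraMap k A d) ↔ ‖c‖ < ‖d‖ := by
  rw [← not_le, hv.le_iff, not_le]

theorem upperBoundSet_nonempty (hv : v.IsScalarBounded k) (f : A) :
    (upperBoundSet k v f).Nonempty := by
  obtain ⟨c, hc⟩ := hv.exists_le f
  by_cases h : c = 0
  · refine ⟨1, one_pos, 1, one_ne_zero, 1, by simp, ?_⟩
    subst h
    simp only [map_zero, le_zero_iff] at hc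
    simp [hc]
  · exact ⟨‖c‖, norm_pos_iff.2 h, 1, one_ne_zero, c, by simp, by simpa using hc⟩

/-- Lower and upper estimates of `f` by scalars are compatible: raise both to a common exponent and
compare in `k`. -/
theorem le_gauge (hv : v.IsScalarBounded k) {f : A} {r : ℝ} (hr : 0 ≤ r) {n : ℕ} {c : k}
    (hc : r ^ n = ‖c‖) (h : v (algebraMap k A c) ≤ v f ^ n) (hn : n ≠ 0) : r ≤ v.gauge k f := by
  refine le_csInf (hv.upperBoundSet_nonempty f) ?_
  rintro s ⟨hs, m, hm, d, hd, h'⟩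
  refine (pow_le_pow_iff_left₀ hr hs.le (mul_ne_zero hn hm)).1 ?_
  rw [pow_mul, hc, mul_comm, pow_mul, hd, ← norm_pow, ← norm_pow, ← hv.le_iff, map_pow, map_pow,
    map_pow, map_pow]
  calc _ ≤ (v f ^ n) ^ m := pow_le_pow_left' h m
    _ = (v f ^ m) ^ n := by rw [← pow_mul, ← pow_mul, mul_comm]
    _ ≤ _ := pow_le_pow_left' h' n

theorem exists_of_gauge_lt (hv : v.IsScalarBounded k) {f : A} {t : ℝ} (h : v.gauge k f < t) :
    ∃ r, 0 < r ∧ r < t ∧ ∃ n : ℕ, n ≠ 0 ∧ ∃ c : k, r ^ n = ‖c‖ ∧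
      v f ^ n ≤ v (algebraMap k A c) := by
  obtain ⟨r, ⟨h0, h1⟩, h2⟩ := exists_lt_of_csInf_lt (hv.upperBoundSet_nonempty f) h
  exact ⟨r, h0, h2, h1⟩

/-- By density there is a root of a scalar norm strictly between `s` and the gauge; it is no upper
bound, so by totality it is a strict lower bound. -/
theorem exists_of_lt_gauge {f : A} {s : ℝ} (hs : 0 ≤ s) (h : s < v.gauge k f) :
    ∃ r, s < r ∧ ∃ n : ℕ, n ≠ 0 ∧ ∃ c : k, c ≠ 0 ∧ r ^ n = ‖c‖ ∧
      v (algebraMap k A c) < v f ^ n := by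
  obtain ⟨r, h1, h2, n, hn, c, hc0, hc⟩ := exists_pow_eq_norm_between k hs h
  refine ⟨r, h1, n, hn, c, hc0, hc, lt_of_not_ge fun h' => ?_⟩
  exact absurd (gauge_le (hs.trans_lt h1) hn hc h') (not_le.2 h2)

theorem gauge_mono (hv : v.IsScalarBounded k) {f g : A} (h : v f ≤ v g) :
    v.gauge k f ≤ v.gauge k g := by
  refine le_of_forall_gt fun t ht => ?_
  obtain ⟨r, hr, hrt, n, hn, c, hc, h'⟩ := hv.exists_of_gauge_lt ht
  exact (gauge_le hr hn hc ((pow_le_pow_left' h n).trans h')).trans_lt hrt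

theorem gauge_algebraMap (hv : v.IsScalarBounded k) (c : k) :
    v.gauge k (algebraMap k A c) = ‖c‖ := by
  refine le_antisymm (le_of_forall_gt fun t ht => ?_)
    (hv.le_gauge (_root_.norm_nonneg c) (c := c) (n := 1) (by simp) (by simp) one_ne_zero)
  obtain ⟨r, h1, h2, n, hn, d, -, hd⟩ := exists_pow_eq_norm_between k (_root_.norm_nonneg c) ht
  refine (gauge_le ((_root_.norm_nonneg c).trans_lt h1) hn hd ?_).trans_lt h2
  rw [← map_pow, ← map_pow, hv.le_iff, norm_pow, ← hd]
  exact pow_le_pow_left₀ (_root_.norm_nonneg _) h1.le n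

theorem gauge_add_le_max (hv : v.IsScalarBounded k) (f g : A) :
    v.gauge k (f + g) ≤ max (v.gauge k f) (v.gauge k g) := by
  refine le_of_forall_gt fun t ht => ?_
  wlog hfg : v f ≤ v g generalizing f g
  · rw [add_comm]
    exact this g f (by rwa [max_comm]) (le_of_not_ge hfg)
  exact (hv.gauge_mono ((v.map_add f g).trans (max_le hfg le_rfl))).trans_lt
    ((le_max_right _ _).trans_lt ht)

theorem gauge_mul_le (hv : v.IsScalarBounded k) (f g : A) :
    v.gauge k (f * g) ≤ v.gauge k f * v.gauge k g := by
  refine le_mul_of_forall_lt₀ fun a ha b hb => ?_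
  obtain ⟨r, hr, hra, n, hn, c, hc, h⟩ := hv.exists_of_gauge_lt ha
  obtain ⟨s, hs, hsb, m, hm, d, hd, h'⟩ := hv.exists_of_gauge_lt hb
  refine (gauge_le (mul_pos hr hs) (mul_ne_zero hn hm) (c := c ^ m * d ^ n) ?_ ?_).trans
    (mul_le_mul hra.le hsb.le hs.le (hr.trans hra).le)
  · rw [mul_pow, pow_mul, hc, mul_comm n, pow_mul, hd]
    simp
  · rw [map_mul, mul_pow, pow_mul, mul_comm n, pow_mul (v g)]
    simpa using mul_le_mul' (pow_le_pow_left' h m) (pow_le_pow_left' h' n)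

theorem le_gauge_mul (hv : v.IsScalarBounded k) (f g : A) :
    v.gauge k f * v.gauge k g ≤ v.gauge k (f * g) := by
  refine mul_le_of_forall_lt_of_nonneg (gauge_nonneg _ _) (gauge_nonneg _ _)
    fun a ha0 ha b hb0 hb => ?_
  obtain ⟨r, har, n, hn, c, -, hc, h⟩ := exists_of_lt_gauge ha0 ha
  obtain ⟨s, hbs, m, hm, d, -, hd, h'⟩ := exists_of_lt_gauge hb0 hb
  refine (mul_le_mul har.le hbs.le hb0 (ha0.trans har.le)).trans
    (hv.le_gauge (mul_nonneg (ha0.trans har.le) (hb0.trans hbs.le))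
    (c := c ^ m * d ^ n) (n := n * m) ?_ ?_ (mul_ne_zero hn hm))
  · rw [mul_pow, pow_mul, hc, mul_comm n, pow_mul, hd]
    simp
  · rw [map_mul v f g, mul_pow, pow_mul, mul_comm n, pow_mul (v g)]
    simpa using mul_le_mul' (pow_le_pow_left' h.le m) (pow_le_pow_left' h'.le n)

theorem gauge_zero (hv : v.IsScalarBounded k) : v.gauge k (0 : A) = 0 := by
  simpa using hv.gauge_algebraMap 0

/-- The gauge of a scalar-bounded valuation as a multiplicative seminorm. -/
def seminorm (hv : v.IsScalarBounded k) : MulRingSeminorm A where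
  toFun := v.gauge k
  map_zero' := hv.gauge_zero
  add_le' f g := (hv.gauge_add_le_max f g).trans
    (max_le_add_of_nonneg (gauge_nonneg _ _) (gauge_nonneg _ _))
  neg' f := le_antisymm (hv.gauge_mono (by simp)) (hv.gauge_mono (by simp))
  map_one' := by simpa using hv.gauge_algebraMap 1
  map_mul' f g := le_antisymm (hv.gauge_mul_le f g) (hv.le_gauge_mul f g)

theorem seminorm_apply (hv : v.IsScalarBounded k) (f : A) : hv.seminorm f = v.gauge k f := rfl

end IsScalarBounded

end Valuation

/-! ### Power-bounded elements from norm estimates -/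

section PowerBounded

variable {k A : Type*} [NormedCommRing A]

theorem mem_powerBounded_of_norm_mul_pow_le {f : A} (h : ∀ (a : A) (n : ℕ), ‖a * f ^ n‖ ≤ ‖a‖) :
    f ∈ powerBounded A := by
  intro U hU
  obtain ⟨r, hr, hrU⟩ := Metric.mem_nhds_iff.1 hU
  refine ⟨Metric.ball 0 r, Metric.ball_mem_nhds _ hr, ?_⟩
  rintro a ha _ ⟨n, rfl⟩
  refine hrU ?_
  rw [mem_ball_zero_iff] at ha ⊢
  exact (h a n).trans_lt ha

theorem mem_powerBounded_of_norm_le_one {f : A} (hf : ‖f‖ ≤ 1) : f ∈ powerBounded A := by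
  refine mem_powerBounded_of_norm_mul_pow_le fun a n => ?_
  induction n with
  | zero => simp
  | succ n ih =>
    rw [pow_succ, ← mul_assoc]
    exact (norm_mul_le _ _).trans ((mul_le_of_le_one_right (norm_nonneg _) hf).trans ih)

theorem algebraMap_mem_powerBounded [NormedField k] [NormedAlgebra k A] {c : k} (hc : ‖c‖ ≤ 1) :
    algebraMap k A c ∈ powerBounded A := by
  refine mem_powerBounded_of_norm_mul_pow_le fun a n => ?_
  rw [← map_pow, mul_comm, ← Algebra.smul_def, norm_smul, norm_pow]
  exact mul_le_of_le_one_left (norm_nonneg _) (pow_le_one₀ (norm_nonneg _) hc)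

end PowerBounded

/-! ### From adic points to seminorms -/

namespace Spa

section Basic

variable {A : Type*} [CommRing A] [TopologicalSpace A] {Aplus : Set A}

theorem vle_iff (x : Spa A Aplus) (f g : A) : x.rel.vle f g ↔ x.val f ≤ x.val g := by
  let := x.rel
  exact Valuation.Compatible.vle_iff_le (v := ValuativeRel.valuation A) f g

theorem ext_val {x y : Spa A Aplus} (h : ∀ f g, x.val f ≤ x.val g ↔ y.val f ≤ y.val g) :
    x = y := by
  refine Spa.ext (ValuativeRel.ext ?_)
  funext f g
  exact propext (by rw [vle_iff, vle_iff, h])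

theorem val_le_one (x : Spa A Aplus) {f : A} (hf : f ∈ Aplus) : x.val f ≤ 1 := x.le_one f hf

/-- The point `y` is a generization of `x` if it lies in all basic open neighbourhoods of `x`. -/
theorem specializes_iff {x y : Spa A Aplus} : y ⤳ x ↔
    ∀ f g, x.val f ≤ x.val g → x.val g ≠ 0 → y.val f ≤ y.val g ∧ y.val g ≠ 0 := by
  rw [specializes_iff_forall_open]
  constructor
  · intro h f g h1 h2
    exact h _ (TopologicalSpace.isOpen_generateFrom_of_mem ⟨f, g, rfl⟩) ⟨h1, h2⟩
  · intro h U hU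
    induction hU with
    | basic s hs =>
      obtain ⟨f, g, rfl⟩ := hs
      exact fun hx => h f g hx.1 hx.2
    | univ => exact fun _ => trivial
    | inter s t _ _ hs ht => exact fun hx => ⟨hs hx.1, ht hx.2⟩
    | sUnion S _ ih => exact fun ⟨s, hs, hx⟩ => ⟨s, hs, ih s hs hx⟩

theorem isOpen_setOf_le (f g : A) : IsOpen {x : Spa A Aplus | x.val f ≤ x.val g ∧ x.val g ≠ 0} :=
  TopologicalSpace.isOpen_generateFrom_of_mem ⟨f, g, rfl⟩

end Basic

section Normed

variable {A : Type*} [NormedCommRing A] {Aplus : Set A}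

/-- Construct a point of the adic spectrum from a valuative relation for which every nonzero
element dominates a ball. -/
def ofRel (R : ValuativeRel A) (h1 : ∀ f ∈ Aplus, R.vle f 1)
    (h2 : ∀ a, ¬ R.vle a 0 → ∃ r > 0, ∀ f, ‖f‖ < r → ¬ R.vle a f) : Spa A Aplus where
  rel := R
  isOpen_lt γ hγ := by
    obtain ⟨a, b, rfl⟩ := ValuativeRel.exists_valuation_div_valuation_eq γ
    have hb : ValuativeRel.valuation A (b : A) ≠ 0 :=
      ValuativeRel.valuation_posSubmonoid_ne_zero b
    have ha : ValuativeRel.valuation A a ≠ 0 := fun h => hγ (by simp [h])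
    obtain ⟨r, hr, hra⟩ := h2 a (by rwa [← ValuativeRel.valuation_eq_zero_iff])
    have key : ∀ f, ¬ R.vle a f ↔ ValuativeRel.valuation A f < ValuativeRel.valuation A a :=
      fun f => by
        rw [← not_le]
        exact not_congr (Valuation.Compatible.vle_iff_le (v := ValuativeRel.valuation A) a f)
    simp only [lt_div_iff₀ (zero_lt_iff.2 hb), ← map_mul]
    -- With `γ` the quotient of the values of `a` and `b`, moving `f` to `g` changes `f * b` by `(g
    -- - f) * b`, which for `g` near `f` lies in the ball dominated by `a`.
    rw [isOpen_iff_mem_nhds]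
    intro f hf
    have hc : Continuous fun g : A => ‖(g - f) * b‖ := by fun_prop
    filter_upwards [hc.tendsto f (Iio_mem_nhds (by simpa using hr))] with g hg
    have h3 := (key _).1 (hra _ hg)
    have h4 : g * b = (g - f) * b + f * b := by ring
    change ValuativeRel.valuation A (g * b) < _
    rw [h4]
    exact (Valuation.map_add _ _ _).trans_lt (max_lt h3 hf)
  le_one f hf := by
    have := (Valuation.Compatible.vle_iff_le (v := ValuativeRel.valuation A) f 1).1 (h1 f hf)
    simpa using this

variable {k : Type*} [NontriviallyNormedField k] [NormedAlgebra k A]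
  (x : Spa A (powerBounded A))

variable (k) in
theorem val_ne_zero_of_ne_zero {c : k} (hc : c ≠ 0) : x.val (algebraMap k A c) ≠ 0 :=
  (((isUnit_iff_ne_zero.2 hc).map (algebraMap k A)).map x.val).ne_zero

/-- The scalars are cofinal in the value group. -/
theorem exists_val_lt {γ : x.ValueGroup₀} (hγ : γ ≠ 0) :
    ∃ c : k, c ≠ 0 ∧ x.val (algebraMap k A c) < γ := by
  have h : ∀ᶠ f in 𝓝 (0 : A), x.val f < γ :=
    (x.isOpen_lt γ hγ).mem_nhds (by simpa using zero_lt_iff.2 hγ)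
  have h' : Tendsto (algebraMap k A) (𝓝[≠] 0) (𝓝 0) := by
    have := (algebraMapCLM k A).continuous.tendsto 0
    simp only [map_zero] at this
    exact this.mono_left nhdsWithin_le_nhds
  obtain ⟨c, hc, hc0⟩ := ((h'.eventually h).and self_mem_nhdsWithin).exists
  exact ⟨c, hc0, hc⟩

theorem val_le_of_norm_le {c : k} (hc : c ≠ 0) {f : A} (hf : ‖f‖ ≤ ‖c‖) :
    x.val f ≤ x.val (algebraMap k A c) := by
  have h : ‖c⁻¹ • f‖ ≤ 1 := by
    rw [norm_smul, norm_inv]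
    exact inv_mul_le_one_of_le₀ hf (norm_nonneg _)
  have h1 := x.val_le_one (mem_powerBounded_of_norm_le_one h)
  have h2 : f = algebraMap k A c * c⁻¹ • f := by
    rw [← Algebra.smul_def, smul_smul, mul_inv_cancel₀ hc, one_smul]
  rw [h2, map_mul]
  exact mul_le_of_le_one_right' h1

theorem val_algebraMap_le {c d : k} (h : ‖c‖ ≤ ‖d‖) :
    x.val (algebraMap k A c) ≤ x.val (algebraMap k A d) := by
  by_cases hd : d = 0
  · subst hd
    have : c = 0 := by simpa using h
    simp [this]
  have h1 : ‖c / d‖ ≤ 1 := by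
    rw [norm_div]
    exact div_le_one_of_le₀ h (norm_nonneg _)
  have h2 : algebraMap k A c = algebraMap k A (c / d) * algebraMap k A d := by
    rw [← map_mul, div_mul_cancel₀ _ hd]
  rw [h2, map_mul]
  exact mul_le_of_le_one_left' (x.val_le_one (algebraMap_mem_powerBounded h1))

/-- If the order were reversed, `d / c` would have norm below `1` but value at least `1`, so its
powers could not fall below a scalar of value less than `1`, contradicting continuity. -/
theorem val_algebraMap_le_iff {c d : k} :
    x.val (algebraMap k A c) ≤ x.val (algebraMap k A d) ↔ ‖c‖ ≤ ‖d‖ := by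
  refine ⟨fun h => ?_, x.val_algebraMap_le⟩
  by_contra! hlt
  have hc : c ≠ 0 := norm_pos_iff.1 ((norm_nonneg d).trans_lt hlt)
  have hx0 := x.val_ne_zero_of_ne_zero k hc
  obtain ⟨e, he0, he⟩ := x.exists_val_lt (k := k) one_ne_zero
  obtain ⟨n, hn⟩ := exists_pow_lt_of_lt_one (norm_pos_iff.2 he0)
    (show ‖d / c‖ < 1 by rw [norm_div]; exact (div_lt_one (norm_pos_iff.2 hc)).2 hlt)
  rw [← norm_pow] at hn
  have h1 := x.val_algebraMap_le hn.le
  have h2 : 1 ≤ x.val (algebraMap k A (d / c)) := by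
    have h3 : algebraMap k A d = algebraMap k A (d / c) * algebraMap k A c := by
      rw [← map_mul, div_mul_cancel₀ _ hc]
    rw [h3, map_mul] at h
    exact le_of_mul_le_mul_right (by simpa using h) (zero_lt_iff.2 hx0)
  rw [map_pow, map_pow] at h1
  exact absurd ((one_le_pow_of_one_le' h2 n).trans h1) (not_le.2 he)

theorem isScalarBounded_val : x.val.IsScalarBounded k where
  le_iff _ _ := x.val_algebraMap_le_iff
  exists_le f := by
    obtain ⟨c, hc⟩ := NormedField.exists_lt_norm k ‖f‖
    exact ⟨c, x.val_le_of_norm_le (norm_pos_iff.1 ((norm_nonneg f).trans_lt hc)) hc.le⟩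

variable (k) in
-- By continuity a nonzero value lies above a nonzero scalar, so passing to the gauge does not
-- enlarge the support.
theorem gauge_eq_zero_iff {f : A} : x.val.gauge k f = 0 ↔ x.val f = 0 := by
  constructor
  · intro h
    by_contra h0
    obtain ⟨c, hc0, hc⟩ := x.exists_val_lt (k := k) h0
    have := x.isScalarBounded_val.le_gauge (norm_nonneg c) (n := 1) (c := c) (f := f) (by simp)
      (by simpa using hc.le) one_ne_zero
    rw [h] at this
    exact hc0 (norm_le_zero_iff.1 this)
  · intro h
    refine le_antisymm ?_ (Valuation.gauge_nonneg _ _)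
    rw [← (x.isScalarBounded_val (k := k)).gauge_zero]
    exact x.isScalarBounded_val.gauge_mono (by simp [h])

variable (k) in
/-- The element of the Berkovich spectrum attached to a point of the adic spectrum. -/
def toBerkovich : BerkovichSpectrum A where
  seminorm := (x.isScalarBounded_val (k := k)).seminorm
  bounded := by
    obtain ⟨u, hu⟩ := NormedField.exists_one_lt_norm k
    refine ⟨‖u‖, by linarith, fun f => ?_⟩
    rw [Valuation.IsScalarBounded.seminorm_apply]
    by_cases hf : f = 0
    · simp [hf, (x.isScalarBounded_val (k := k)).gauge_zero]
    -- Rounding `‖f‖` up to a power of `‖u‖` costs at most the factor `‖u‖`, whence the constant.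
    obtain ⟨n, h1, h2⟩ := exists_mem_Ioc_zpow (norm_pos_iff.2 hf) hu
    have hu0 : u ≠ 0 := norm_pos_iff.1 (by linarith)
    rw [← norm_zpow] at h1 h2
    have h3 := x.val_le_of_norm_le (zpow_ne_zero _ hu0) h2
    refine (x.isScalarBounded_val.gauge_mono h3).trans ?_
    rw [(x.isScalarBounded_val (k := k)).gauge_algebraMap, zpow_add_one₀ hu0, norm_mul, mul_comm]
    exact mul_le_mul_of_nonneg_left h1.le (norm_nonneg u)

variable (k) in
theorem toBerkovich_apply (f : A) : (x.toBerkovich k).seminorm f = x.val.gauge k f := rfl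

end Normed

end Spa

/-- Exponential growth beats linear growth. The constant absorbs boundedness constants, and `n + 1`
the number of terms in a binomial expansion. -/
theorem le_of_forall_pow_le_mul_succ_mul_pow {a b C : ℝ} (hb : 0 ≤ b)
    (h : ∀ n : ℕ, a ^ n ≤ C * (n + 1) * b ^ n) : a ≤ b := by
  by_contra! hab
  rcases hb.eq_or_lt with rfl | hb
  · have := h 1
    norm_num at this
    linarith
  have ht : 1 < a / b := (one_lt_div hb).2 hab
  have h0 := (((tendsto_pow_const_div_const_pow_of_one_lt 1 ht).add
    (tendsto_pow_const_div_const_pow_of_one_lt 0 ht)).const_mul C)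
  simp only [add_zero, mul_zero] at h0
  obtain ⟨n, hn⟩ := (h0.eventually (gt_mem_nhds one_pos)).exists
  have hpos : 0 < (a / b) ^ n := pow_pos (one_pos.trans ht) n
  have h1 : C * ((n + 1) / (a / b) ^ n) < 1 := by
    simpa [add_div] using hn
  rw [← mul_div_assoc, div_lt_one hpos, div_pow, lt_div_iff₀ (pow_pos hb n)] at h1
  exact absurd (h n) (not_le.2 h1)

/-! ### From seminorms to adic points -/

namespace BerkovichSpectrum

section Basic

variable {A : Type*} [NormedCommRing A]

@[ext]
theorem ext {p p' : BerkovichSpectrum A} (h : ∀ f, p.seminorm f = p'.seminorm f) : p = p' := by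
  obtain ⟨p, _⟩ := p
  obtain ⟨p', _⟩ := p'
  congr
  exact DFunLike.ext _ _ h

theorem continuous_apply (f : A) : Continuous fun p : BerkovichSpectrum A => p.seminorm f :=
  (_root_.continuous_apply f).comp continuous_induced_dom

instance : T2Space (BerkovichSpectrum A) :=
  T2Space.of_injective_continuous (f := fun (p : BerkovichSpectrum A) (f : A) => p.seminorm f)
    (fun _ _ h => ext fun f => congrFun h f) continuous_induced_dom

end Basic

variable {k A : Type*} [NontriviallyNormedField k] [NormedCommRing A] [NormedAlgebra k A]
  (p : BerkovichSpectrum A)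

/-- Boundedness applied to powers gives `≤`; the same for `c⁻¹` gives equality. -/
theorem seminorm_algebraMap (c : k) : p.seminorm (algebraMap k A c) = ‖c‖ := by
  obtain ⟨C, hC, hp⟩ := p.bounded
  have key : ∀ c : k, p.seminorm (algebraMap k A c) ≤ ‖c‖ := fun c => by
    refine le_of_forall_pow_le_mul_succ_mul_pow (C := C * ‖(1 : A)‖) (norm_nonneg c) fun n => ?_
    rw [← map_pow, ← map_pow]
    refine (hp _).trans ?_
    rw [norm_algebraMap, norm_pow]
    have h1 : 0 ≤ C * ‖(1 : A)‖ * ‖c‖ ^ n := by positivity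
    have h2 : (0 : ℝ) ≤ n := Nat.cast_nonneg n
    nlinarith [mul_nonneg h1 h2]
  refine le_antisymm (key c) ?_
  by_cases hc : c = 0
  · simp [hc]
  have h1 := key c⁻¹
  have h2 : p.seminorm (algebraMap k A c) * p.seminorm (algebraMap k A c⁻¹) = 1 := by
    rw [← map_mul, ← map_mul, mul_inv_cancel₀ hc, map_one, map_one]
  have h3 : 0 < ‖c‖ := norm_pos_iff.2 hc
  rw [norm_inv] at h1
  have h4 := mul_le_mul_of_nonneg_left h1 (apply_nonneg p.seminorm (algebraMap k A c))
  rw [h2, ← div_eq_mul_inv, le_div_iff₀ h3, one_mul] at h4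
  exact h4

theorem seminorm_le_one_of_mem_powerBounded (k : Type*) [NontriviallyNormedField k]
    [NormedAlgebra k A] {f : A} (hf : f ∈ powerBounded A) :
    p.seminorm f ≤ 1 := by
  obtain ⟨C, hC, hp⟩ := p.bounded
  obtain ⟨V, hV, hVU⟩ := hf _ (Metric.ball_mem_nhds 0 one_pos)
  have h' : Tendsto (algebraMap k A) (𝓝[≠] 0) (𝓝 0) := by
    have := (algebraMapCLM k A).continuous.tendsto 0
    simp only [map_zero] at this
    exact this.mono_left nhdsWithin_le_nhds
  obtain ⟨c, hc, hc0⟩ := ((h'.eventually hV).and self_mem_nhdsWithin).exists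
  have hc1 : 0 < ‖c‖ := norm_pos_iff.2 hc0
  refine le_of_forall_pow_le_mul_succ_mul_pow (C := C / ‖c‖) zero_le_one fun n => ?_
  have h1 := hVU _ hc _ ⟨n, rfl⟩
  rw [mem_ball_zero_iff] at h1
  have h2 := (hp _).trans (mul_le_mul_of_nonneg_left h1.le hC.le)
  rw [map_mul, seminorm_algebraMap, map_pow, mul_one, mul_comm, ← le_div_iff₀ hc1] at h2
  refine h2.trans ?_
  rw [one_pow, mul_one]
  have : (0 : ℝ) ≤ n := Nat.cast_nonneg n
  have h3 : 0 ≤ C / ‖c‖ := by positivity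
  nlinarith [mul_nonneg h3 this]

variable (k) in
-- Expand `(f + g) ^ n`: the binomial coefficients have seminorm at most `1` because `k` is
-- ultrametric, so only the number of terms is lost.
theorem isNonarchimedean_seminorm [IsUltrametricDist k] (f g : A) :
    p.seminorm (f + g) ≤ max (p.seminorm f) (p.seminorm g) := by
  have hm : 0 ≤ max (p.seminorm f) (p.seminorm g) := le_max_of_le_left (apply_nonneg _ _)
  have hnat : ∀ m : ℕ, p.seminorm (m : A) ≤ 1 := fun m => by
    rw [← map_natCast (algebraMap k A), seminorm_algebraMap]
    exact IsUltrametricDist.norm_natCast_le_one k m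
  refine le_of_forall_pow_le_mul_succ_mul_pow (C := 1) hm fun n => ?_
  rw [← map_pow, add_pow]
  refine (Finset.le_sum_of_subadditive p.seminorm (map_zero p.seminorm).le
    (map_add_le_add p.seminorm) _ _).trans ?_
  refine (Finset.sum_le_card_nsmul _ _ (max (p.seminorm f) (p.seminorm g) ^ n)
    fun m hm' => ?_).trans ?_
  · rw [map_mul, map_mul, map_pow, map_pow]
    have hmn : m + (n - m) = n := by
      have := Finset.mem_range.1 hm'
      omega
    calc _ ≤ p.seminorm f ^ m * p.seminorm g ^ (n - m) * 1 := by
          gcongr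
          exact hnat _
      _ ≤ max (p.seminorm f) (p.seminorm g) ^ m * max (p.seminorm f) (p.seminorm g) ^ (n - m) := by
          rw [mul_one]
          gcongr
          · exact le_max_left _ _
          · exact le_max_right _ _
      _ = _ := by rw [← pow_add, hmn]
  · simp

variable (k) in
/-- The point of the adic spectrum given by an element of the Berkovich spectrum. -/
def toSpa [IsUltrametricDist k] : Spa A (powerBounded A) :=
  Spa.ofRel
    { vle f g := p.seminorm f ≤ p.seminorm g
      vle_total _ _ := le_total _ _
      vle_trans := le_trans
      vle_add h h' := (p.isNonarchimedean_seminorm k _ _).trans (max_le h h')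
      mul_vle_mul_left h z := by
        rw [map_mul, map_mul]
        exact mul_le_mul_of_nonneg_right h (apply_nonneg _ _)
      vle_mul_cancel h0 h := by
        rw [map_zero, not_le] at h0
        rw [map_mul, map_mul] at h
        exact le_of_mul_le_mul_right h h0
      not_vle_one_zero := by simp
      vle_mul_comm := by simp [mul_comm] }
    (fun f hf => by
      change p.seminorm f ≤ p.seminorm 1
      simpa using p.seminorm_le_one_of_mem_powerBounded k hf)
    (fun a ha => by
      change ¬ p.seminorm a ≤ p.seminorm 0 at ha
      rw [map_zero, not_le] at ha
      obtain ⟨C, hC, hp⟩ := p.bounded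
      refine ⟨p.seminorm a / C, by positivity, fun f hf => ?_⟩
      rw [lt_div_iff₀ hC, mul_comm] at hf
      exact not_le.2 ((hp f).trans_lt hf))

variable {p} {x : Spa A (powerBounded A)}

/-- On scalars `p` is the norm, so the order determined by `p`, tested against scalars, recovers `p`
itself. This gives uniqueness of the representing seminorm. -/
theorem Represents.toBerkovich_eq (h : p.Represents x) : x.toBerkovich k = p := by
  refine ext fun f => ?_
  rw [Spa.toBerkovich_apply]
  have hp : ∀ n : ℕ, p.seminorm f ^ n = p.seminorm (f ^ n) := fun n => (map_pow _ _ _).symm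
  refine le_antisymm (le_of_forall_gt fun t ht => ?_) ?_
  · obtain ⟨r, h1, h2, n, hn, c, -, hc⟩ :=
      exists_pow_eq_norm_between k (apply_nonneg p.seminorm f) ht
    have h0 := apply_nonneg p.seminorm f
    refine (Valuation.gauge_le (h0.trans_lt h1) hn hc ?_).trans_lt h2
    rw [← map_pow, ← h, ← hp, seminorm_algebraMap, ← hc]
    exact pow_le_pow_left₀ h0 h1.le n
  · by_contra! hlt
    obtain ⟨r, h1, h2, n, hn, c, -, hc⟩ :=
      exists_pow_eq_norm_between k (Valuation.gauge_nonneg _ _) hlt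
    have hr : 0 ≤ r := (Valuation.gauge_nonneg _ _).trans h1.le
    refine absurd (x.isScalarBounded_val.le_gauge hr hc ?_ hn) (not_le.2 h1)
    rw [← map_pow, ← h, ← hp, seminorm_algebraMap, ← hc]
    exact pow_le_pow_left₀ hr h2.le n

variable [IsUltrametricDist k]

variable (p k) in
theorem represents_toSpa : p.Represents (p.toSpa k) := fun f g =>
  (Spa.vle_iff (p.toSpa k) f g)

theorem Represents.eq_toSpa (h : p.Represents x) : x = p.toSpa k :=
  Spa.ext_val fun f g => by rw [← h, p.represents_toSpa k]

variable (k) in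
theorem toBerkovich_toSpa (p : BerkovichSpectrum A) : (p.toSpa k).toBerkovich k = p :=
  (p.represents_toSpa k).toBerkovich_eq

end BerkovichSpectrum

/-! ### Specializations and maximal generizations -/

namespace Spa

variable {k A : Type*} [NontriviallyNormedField k] [NormedCommRing A] [NormedAlgebra k A]
  {x y : Spa A (powerBounded A)}

/-- The estimates defining the gauge at `x` compare with nonzero scalars, so they cut out basic open
neighbourhoods of `x` and also hold at `y`. -/
theorem toBerkovich_eq_of_specializes (h : y ⤳ x) : y.toBerkovich k = x.toBerkovich k := by
  rw [specializes_iff] at h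
  refine BerkovichSpectrum.ext fun f => ?_
  rw [toBerkovich_apply, toBerkovich_apply]
  refine le_antisymm (le_of_forall_gt fun t ht => ?_) ?_
  · obtain ⟨r, hr, hrt, n, hn, c, hc, h'⟩ := x.isScalarBounded_val.exists_of_gauge_lt ht
    have hc0 : c ≠ 0 := norm_pos_iff.1 (hc ▸ pow_pos hr n)
    refine (Valuation.gauge_le hr hn hc ?_).trans_lt hrt
    rw [← map_pow] at h' ⊢
    exact (h _ _ h' (x.val_ne_zero_of_ne_zero k hc0)).1
  · by_contra! hlt
    obtain ⟨r, h1, n, hn, c, hc0, hc, h'⟩ :=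
      Valuation.IsScalarBounded.exists_of_lt_gauge (Valuation.gauge_nonneg _ _) hlt
    rw [← map_pow] at h'
    refine absurd (y.isScalarBounded_val.le_gauge ((Valuation.gauge_nonneg _ _).trans h1.le) hc
      ?_ hn) (not_le.2 h1)
    rw [← map_pow]
    exact (h _ _ h'.le (ne_zero_of_lt h')).1

variable [IsUltrametricDist k]

variable (k x) in
theorem toSpa_toBerkovich_specializes : (x.toBerkovich k).toSpa k ⤳ x := by
  rw [specializes_iff]
  intro f g h h0
  refine ⟨(BerkovichSpectrum.represents_toSpa k _ f g).1 (x.isScalarBounded_val.gauge_mono h),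
    fun h1 => ?_⟩
  have h2 := (BerkovichSpectrum.represents_toSpa k (x.toBerkovich k) g 0).2 (by simp [h1])
  rw [map_zero, toBerkovich_apply] at h2
  exact h0 ((x.gauge_eq_zero_iff k).1 (le_antisymm h2 (Valuation.gauge_nonneg _ _)))

theorem eq_toSpa_of_specializes {p : BerkovichSpectrum A} (h : y ⤳ p.toSpa k) :
    y = p.toSpa k := by
  have hy : ∀ f, p.seminorm f = y.val.gauge k f := fun f => by
    rw [← toBerkovich_apply, toBerkovich_eq_of_specializes (k := k) h,
        BerkovichSpectrum.toBerkovich_toSpa k p]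
  refine BerkovichSpectrum.Represents.eq_toSpa fun f g => ⟨fun hfg => ?_, fun hfg => ?_⟩
  -- Where `g` does not vanish the inequality is a basic open condition; where it does, `f` vanishes
  -- too and the supports agree.
  · by_cases hg : p.seminorm g = 0
    · have hf : y.val.gauge k f = 0 := by
        rw [← hy]
        exact le_antisymm (hg ▸ hfg) (apply_nonneg _ _)
      rw [(y.gauge_eq_zero_iff k).1 hf]
      exact zero_le
    · refine (specializes_iff.1 h f g ((p.represents_toSpa k f g).1 hfg) fun h0 => hg ?_).1
      have := (p.represents_toSpa k g 0).2 (by simp [h0])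
      rw [map_zero] at this
      exact le_antisymm this (apply_nonneg _ _)
  · rw [hy, hy]
    exact y.isScalarBounded_val.gauge_mono hfg

variable (k) in
theorem isMaximalGenerization_iff {η : Spa A (powerBounded A)} :
    IsMaximalGenerization η x ↔ η = (x.toBerkovich k).toSpa k := by
  constructor
  · rintro ⟨h1, h2⟩
    rw [← toBerkovich_eq_of_specializes h1]
    exact (h2 _ (η.toSpa_toBerkovich_specializes k)).symm
  · rintro rfl
    exact ⟨x.toSpa_toBerkovich_specializes k, fun y hy => eq_toSpa_of_specializes hy⟩

end Spa

/-- The convex subgroup generated by an element `h ≤ 1` of a linearly ordered commutative group. -/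
def Subgroup.convexClosure {G : Type*} [CommGroup G] [LinearOrder G] [IsOrderedMonoid G] (h : G) :
    Subgroup G where
  carrier := {g | ∃ n : ℕ, h ^ n ≤ g ∧ h ^ n ≤ g⁻¹}
  one_mem' := ⟨0, by simp⟩
  mul_mem' := by
    rintro a b ⟨n, h1, h2⟩ ⟨m, h3, h4⟩
    refine ⟨n + m, ?_, ?_⟩
    · rw [pow_add]
      exact mul_le_mul' h1 h3
    · rw [pow_add, mul_inv]
      exact mul_le_mul' h2 h4
  inv_mem' := by
    rintro a ⟨n, h1, h2⟩
    exact ⟨n, h2, by rwa [inv_inv]⟩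

/-! ### Rank one points -/

namespace Spa

variable {k A : Type*} [NontriviallyNormedField k] [NormedCommRing A] [NormedAlgebra k A]
  {x : Spa A (powerBounded A)}

theorem exists_val_div_eq (x : Spa A (powerBounded A)) (γ : (x.ValueGroup₀)ˣ) :
    ∃ a b : A, x.val a ≠ 0 ∧ x.val b ≠ 0 ∧ (γ : x.ValueGroup₀) = x.val a / x.val b := by
  let := x.rel
  obtain ⟨a, b, h⟩ :=
    ValuativeRel.exists_valuation_posSubmonoid_div_valuation_posSubmonoid_eq (R := A) γ
  exact ⟨a, b, ValuativeRel.valuation_posSubmonoid_ne_zero a,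
    ValuativeRel.valuation_posSubmonoid_ne_zero b, h.symm⟩

theorem top_ne_bot_valueGroup₀ (k : Type*) [NontriviallyNormedField k] [NormedAlgebra k A]
    (x : Spa A (powerBounded A)) :
    (⊤ : Subgroup (x.ValueGroup₀)ˣ) ≠ ⊥ := by
  obtain ⟨c, hc0, hc⟩ := x.exists_val_lt (k := k) one_ne_zero
  intro h
  have h1 : Units.mk0 _ (x.val_ne_zero_of_ne_zero k hc0) ∈ (⊤ : Subgroup (x.ValueGroup₀)ˣ) :=
    Subgroup.mem_top _
  rw [h, Subgroup.mem_bot] at h1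
  have h2 := congrArg Units.val h1
  simp only [Units.val_mk0, Units.val_one] at h2
  exact hc.ne h2

theorem _root_.BerkovichSpectrum.Represents.rank_eq_one {p : BerkovichSpectrum A}
    (hp : p.Represents x) (k : Type*) [NontriviallyNormedField k] [NormedAlgebra k A] :
    x.rank = 1 := by
  refine Set.encard_eq_one.2 ⟨⊤, Set.eq_singleton_iff_unique_mem.2
    ⟨⟨x.top_ne_bot_valueGroup₀ k, fun _ _ _ _ _ => Subgroup.mem_top _⟩, ?_⟩⟩
  rintro H ⟨hH, hconv⟩
  have hpos : ∀ f, x.val f ≠ 0 → 0 < p.seminorm f := fun f hf => by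
    refine lt_of_not_ge fun h => hf ?_
    simpa using (hp f 0).1 (by simpa using h)
  have hlt : ∀ f g, x.val f < x.val g → p.seminorm f < p.seminorm g := fun f g h => by
    rwa [← not_le, hp, not_le]
  obtain ⟨h, hh, h1⟩ := H.bot_or_exists_ne_one.resolve_left hH
  obtain ⟨h, hh, h1⟩ : ∃ h ∈ H, h < 1 := by
    rcases lt_or_gt_of_ne h1 with h2 | h2
    · exact ⟨h, hh, h2⟩
    · exact ⟨_, H.inv_mem hh, inv_lt_one'.2 h2⟩
  -- Archimedean property: real values below `1` have powers tending to zero, so some `h ^ n` lies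
  -- below `g`, and convexity applies.
  have key : ∀ g ≤ 1, g ∈ H := fun g hg => by
    obtain ⟨a, b, ha, hb, hab⟩ := x.exists_val_div_eq g
    obtain ⟨c, d, hc, hd, hcd⟩ := x.exists_val_div_eq h
    have h2 : (h : x.ValueGroup₀) < 1 := by exact_mod_cast h1
    rw [hcd, div_lt_one₀ (zero_lt_iff.2 hd)] at h2
    obtain ⟨n, hn⟩ := exists_pow_lt_of_lt_one (div_pos (hpos a ha) (hpos b hb))
      ((div_lt_one (hpos d hd)).2 (hlt _ _ h2))
    refine hconv g (h ^ n) (H.pow_mem hh n) ?_ hg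
    rw [div_pow, div_lt_div_iff₀ (pow_pos (hpos d hd) n) (hpos b hb)] at hn
    simp only [← map_pow, ← map_mul] at hn
    have h3 := (hp _ _).1 hn.le
    rw [map_mul, map_mul, map_pow, map_pow] at h3
    rw [← Units.val_le_val, Units.val_pow_eq_pow_val, hab, hcd, div_pow,
      div_le_div_iff₀ (zero_lt_iff.2 (pow_ne_zero n hd)) (zero_lt_iff.2 hb)]
    exact h3
  refine (Subgroup.eq_top_iff' H).2 fun g => ?_
  rcases le_total g 1 with hg | hg
  · exact key g hg
  · simpa using H.inv_mem (key _ (inv_le_one'.2 hg))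

variable (k) in
theorem represents_toBerkovich_of_rank_eq_one (hx : x.rank = 1) :
    (x.toBerkovich k).Represents x := by
  intro f g
  refine ⟨fun h => ?_, fun h => x.isScalarBounded_val.gauge_mono h⟩
  contrapose! h
  have hf0 : x.val f ≠ 0 := ne_zero_of_lt h
  have hf : 0 < x.val.gauge k f :=
    (Valuation.gauge_nonneg _ _).lt_of_ne fun e => hf0 ((x.gauge_eq_zero_iff k).1 e.symm)
  rw [toBerkovich_apply, toBerkovich_apply]
  by_cases hg0 : x.val g = 0
  · rwa [(x.gauge_eq_zero_iff k).2 hg0]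
  set γ : (x.ValueGroup₀)ˣ := Units.mk0 _ hg0 / Units.mk0 _ hf0 with hγ
  have hγ1 : γ < 1 := by
    rw [hγ, div_lt_one', ← Units.val_lt_val]
    exact h
  have hmem : γ ∈ Subgroup.convexClosure γ :=
    ⟨1, by simp, by simpa using hγ1.le.trans (one_le_inv'.2 hγ1.le)⟩
  obtain ⟨H, hH⟩ := Set.encard_eq_one.1 hx
  have htop : (⊤ : Subgroup (x.ValueGroup₀)ˣ) = H := by
    rw [← Set.mem_singleton_iff, ← hH]
    exact ⟨x.top_ne_bot_valueGroup₀ k, fun _ _ _ _ _ => Subgroup.mem_top _⟩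
  have hclos : Subgroup.convexClosure γ = H := by
    rw [← Set.mem_singleton_iff, ← hH]
    refine ⟨fun e => ?_, ?_⟩
    · rw [e, Subgroup.mem_bot] at hmem
      exact hγ1.ne hmem
    · rintro g h ⟨n, h1, -⟩ h2 h3
      exact ⟨n, h1.trans h2, (h1.trans h2).trans (h3.trans (one_le_inv'.2 h3))⟩
  obtain ⟨c, hc0, hc⟩ := x.exists_val_lt (k := k) one_ne_zero
  have hc1 : ‖c‖ < 1 := by
    have := (x.isScalarBounded_val (k := k)).lt_iff c 1
    simpa [hc] using this
  -- The convex subgroup of `γ` is everything, so some `γ ^ n` is at most the value of the small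
  -- scalar `c`. Since `‖c‖ < 1`, this forces strict inequality of gauges.
  obtain ⟨n, hn, -⟩ : Units.mk0 _ (x.val_ne_zero_of_ne_zero k hc0) ∈ Subgroup.convexClosure γ := by
    rw [hclos, ← htop]
    exact Subgroup.mem_top _
  have hn0 : n ≠ 0 := by
    rintro rfl
    rw [pow_zero, ← Units.val_le_val] at hn
    exact absurd hc (not_lt.2 hn)
  rw [← Units.val_le_val, hγ, Units.val_pow_eq_pow_val, Units.val_div_eq_div_val, Units.val_mk0,
    Units.val_mk0, Units.val_mk0, div_pow, div_le_iff₀ (zero_lt_iff.2 (pow_ne_zero n hf0)),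
    ← map_pow, ← map_pow, ← map_mul] at hn
  have h1 := (x.isScalarBounded_val (k := k)).gauge_mono hn
  rw [← x.isScalarBounded_val.seminorm_apply, ← x.isScalarBounded_val.seminorm_apply, map_mul,
    map_pow, map_pow, x.isScalarBounded_val.seminorm_apply, x.isScalarBounded_val.seminorm_apply,
    x.isScalarBounded_val.seminorm_apply, x.isScalarBounded_val.gauge_algebraMap] at h1
  refine lt_of_pow_lt_pow_left₀ n hf.le (h1.trans_lt ?_)
  exact mul_lt_of_lt_one_left (pow_pos hf n) hc1

end Spa

/-! ### Continuity, compactness and the quotient property -/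

namespace Spa

variable {k A : Type*} [NontriviallyNormedField k] [NormedCommRing A] [NormedAlgebra k A]

theorem isOpen_setOf_val_le_scalar {c : k} (hc : c ≠ 0) (f : A) :
    IsOpen {x : Spa A (powerBounded A) | x.val f ≤ x.val (algebraMap k A c)} := by
  convert isOpen_setOf_le f (algebraMap k A c) using 3 with x
  simp [x.val_ne_zero_of_ne_zero k hc]

theorem isOpen_setOf_scalar_le_val {c : k} (hc : c ≠ 0) (f : A) :
    IsOpen {x : Spa A (powerBounded A) | x.val (algebraMap k A c) ≤ x.val f} := by
  convert isOpen_setOf_le (algebraMap k A c) f using 3 with x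
  refine ⟨fun h => ⟨h, fun h0 => x.val_ne_zero_of_ne_zero k hc ?_⟩, fun h => h.1⟩
  exact le_zero_iff.1 (h0 ▸ h)

variable (k) in
theorem continuous_gauge (f : A) :
    Continuous fun x : Spa A (powerBounded A) => x.val.gauge k f := by
  rw [continuous_iff_lower_upperSemicontinuous]
  constructor
  · intro x t ht
    rcases lt_or_ge t 0 with h0 | h0
    · exact Eventually.of_forall fun y => h0.trans_le (Valuation.gauge_nonneg _ _)
    obtain ⟨r, h1, n, hn, c, hc0, hc, h'⟩ := Valuation.IsScalarBounded.exists_of_lt_gauge h0 ht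
    filter_upwards [(isOpen_setOf_scalar_le_val hc0 (f ^ n)).mem_nhds
      (show x.val _ ≤ x.val _ by simpa using h'.le)] with y hy
    have hy' : y.val (algebraMap k A c) ≤ y.val (f ^ n) := hy
    rw [map_pow] at hy'
    exact h1.trans_le (y.isScalarBounded_val.le_gauge (h0.trans h1.le) hc hy' hn)
  · intro x t ht
    obtain ⟨r, hr, hrt, n, hn, c, hc, h'⟩ := x.isScalarBounded_val.exists_of_gauge_lt ht
    have hc0 : c ≠ 0 := norm_pos_iff.1 (hc ▸ pow_pos hr n)
    filter_upwards [(isOpen_setOf_val_le_scalar hc0 (f ^ n)).mem_nhds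
      (show x.val _ ≤ x.val _ by simpa using h')] with y hy
    have hy' : y.val (f ^ n) ≤ y.val (algebraMap k A c) := hy
    rw [map_pow] at hy'
    exact (Valuation.gauge_le hr hn hc hy').trans_lt hrt

variable (k) in
theorem continuous_toBerkovich :
    Continuous (toBerkovich k : Spa A (powerBounded A) → BerkovichSpectrum A) :=
  continuous_induced_rng.2 (continuous_pi fun f => continuous_gauge k f)

/-- The limit of an ultrafilter on the adic spectrum: elements that are eventually dominated by
every nonzero scalar become zero. -/
def ultrafilterLim (k : Type*) [NontriviallyNormedField k] [NormedAlgebra k A]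
    (F : Ultrafilter (Spa A (powerBounded A))) : Spa A (powerBounded A) :=
  ofRel
    -- The first alternative alone may give a discontinuous valuation; the second ensures that
    -- elements not made zero dominate a nonzero scalar, hence a ball.
    { vle f g := (∀ᶠ x : Spa A (powerBounded A) in F, x.val f ≤ x.val g) ∨
        ∀ c : k, c ≠ 0 → ∀ᶠ x : Spa A (powerBounded A) in F, x.val f ≤ x.val (algebraMap k A c)
      vle_total f g := by
        rcases F.eventually_or.1 (Eventually.of_forall fun x => le_total (x.val f) (x.val g))
          with h | h
        · exact Or.inl (Or.inl h)
        · exact Or.inr (Or.inl h)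
      vle_trans := by
        rintro g f h (h1 | h1) (h2 | h2)
        · exact Or.inl (h1.mp (h2.mono fun x h2 h1 => h1.trans h2))
        · exact Or.inr fun c hc => h1.mp ((h2 c hc).mono fun x h2 h1 => h1.trans h2)
        · exact Or.inr h1
        · exact Or.inr h1
      vle_add := by
        have key : ∀ {a b z : A}, (∀ᶠ x : Spa A (powerBounded A) in F, x.val a ≤ x.val z) →
            (∀ᶠ x : Spa A (powerBounded A) in F, x.val b ≤ x.val z) →
                ∀ᶠ x : Spa A (powerBounded A) in F, x.val (a + b) ≤ x.val z :=
          fun h1 h2 => h1.mp (h2.mono fun x h2 h1 => (x.val.map_add _ _).trans (max_le h1 h2))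
        have key' : ∀ {a b z : A}, (∀ᶠ x : Spa A (powerBounded A) in F, x.val a ≤ x.val z) →
            (∀ c : k, c ≠ 0 →
                ∀ᶠ x : Spa A (powerBounded A) in F, x.val b ≤ x.val (algebraMap k A c)) →
            (∀ᶠ x : Spa A (powerBounded A) in F, x.val (a + b) ≤ x.val z) ∨
            ∀ c : k, c ≠ 0 →
                ∀ᶠ x : Spa A (powerBounded A) in F, x.val (a + b) ≤ x.val (algebraMap k A c) := by
          intro a b z h1 h2
          -- Either `z` is infinitesimal too, and then so is the sum, or some scalar is eventually
          -- below `z` and `b` is negligible.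
          by_cases hz : ∀ c : k, c ≠ 0 →
              ∀ᶠ x : Spa A (powerBounded A) in F, x.val z ≤ x.val (algebraMap k A c)
          · exact Or.inr fun c hc =>
              key (h1.mp ((hz c hc).mono fun x h2 h1 => h1.trans h2)) (h2 c hc)
          · push Not at hz
            obtain ⟨c, hc, hz⟩ := hz
            refine Or.inl (key h1 ?_)
            exact (h2 c hc).mp (hz.mono fun x h1 h2 => h2.trans h1.le)
        rintro a b z (h1 | h1) (h2 | h2)
        · exact Or.inl (key h1 h2)
        · exact key' h1 h2
        · rw [add_comm]
          exact key' h2 h1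
        · exact Or.inr fun c hc => key (h1 c hc) (h2 c hc)
      mul_vle_mul_left := by
        rintro f g (h | h) z
        · exact Or.inl (h.mono fun x hx => by
            rw [map_mul, map_mul]
            exact mul_le_mul_left hx _)
        · right
          obtain ⟨d, hd⟩ := NormedField.exists_lt_norm k ‖z‖
          have hd0 : d ≠ 0 := norm_pos_iff.1 ((norm_nonneg z).trans_lt hd)
          intro c hc
          filter_upwards [h (c / d) (div_ne_zero hc hd0)] with x hx
          rw [map_mul, ← div_mul_cancel₀ c hd0, map_mul, map_mul]
          exact mul_le_mul' hx (x.val_le_of_norm_le hd0 hd.le)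
      vle_mul_cancel := by
        rintro f g z hz h
        have hz' : ∃ d : k, d ≠ 0 ∧
            ∀ᶠ x : Spa A (powerBounded A) in F, x.val (algebraMap k A d) ≤ x.val z := by
          push Not at hz
          obtain ⟨d, hd, hz⟩ := hz.2
          exact ⟨d, hd, hz.mono fun x => le_of_lt⟩
        obtain ⟨d, hd, hz'⟩ := hz'
        have hz0 : ∀ᶠ x : Spa A (powerBounded A) in F, 0 < x.val z :=
          hz'.mono fun x hx => (zero_lt_iff.2 (x.val_ne_zero_of_ne_zero k hd)).trans_le hx
        rcases h with h | h
        · left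
          filter_upwards [h, hz0] with x hx hz
          rw [map_mul, map_mul] at hx
          exact le_of_mul_le_mul_right hx hz
        · right
          intro c hc
          filter_upwards [h (c * d) (mul_ne_zero hc hd), hz', hz0] with x hx hz hz0
          rw [map_mul, map_mul, map_mul] at hx
          exact le_of_mul_le_mul_right (hx.trans (mul_le_mul_right hz _)) hz0
      not_vle_one_zero := by
        rintro (h | h)
        · obtain ⟨x, hx⟩ := h.exists
          simp at hx
        · obtain ⟨c, hc, hc1⟩ := NormedField.exists_norm_lt_one k
          obtain ⟨x, hx⟩ := (h c (norm_pos_iff.1 hc)).exists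
          rw [← map_one (algebraMap k A), x.val_algebraMap_le_iff, norm_one] at hx
          exact absurd hc1 (not_lt.2 hx)
      vle_mul_comm := Or.inl (Eventually.of_forall fun x => by rw [mul_comm]) }
    (fun f hf => Or.inl (Eventually.of_forall fun x => by simpa using x.val_le_one hf))
    (fun a ha => by
      change ¬ (_ ∨ _) at ha
      push Not at ha
      obtain ⟨-, c, hc, ha⟩ := ha
      obtain ⟨d, hd0, hd⟩ := NormedField.exists_norm_lt k (norm_pos_iff.2 hc)
      have hd0' : d ≠ 0 := norm_pos_iff.1 hd0
      refine ⟨‖d‖, hd0, fun f hf => ?_⟩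
      change ¬ (_ ∨ _)
      push Not
      have h1 : ∀ x : Spa A (powerBounded A), x.val f < x.val (algebraMap k A c) := fun x =>
        (x.val_le_of_norm_le hd0' hf.le).trans_lt (by rwa [x.isScalarBounded_val.lt_iff])
      exact ⟨ha.mono fun x hx => (h1 x).trans hx, c, hc, ha⟩)

variable (k) in
theorem val_ultrafilterLim_le_iff (F : Ultrafilter (Spa A (powerBounded A))) (f g : A) :
    (ultrafilterLim k F).val f ≤ (ultrafilterLim k F).val g ↔
      (∀ᶠ x : Spa A (powerBounded A) in F, x.val f ≤ x.val g) ∨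
        ∀ c : k, c ≠ 0 → ∀ᶠ x : Spa A (powerBounded A) in F, x.val f ≤ x.val (algebraMap k A c) :=
  (vle_iff _ f g).symm

/-- Each ultrafilter converges to `ultrafilterLim`: if `g` is nonzero there, it eventually exceeds a
fixed scalar, so both alternatives for `f` against `g` become the honest inequality. -/
theorem compactSpace (k : Type*) [NontriviallyNormedField k] [NormedAlgebra k A] :
    CompactSpace (Spa A (powerBounded A)) := by
  refine ⟨isCompact_iff_ultrafilter_le_nhds.2 fun F _ => ⟨ultrafilterLim k F, trivial, ?_⟩⟩
  rw [TopologicalSpace.nhds_generateFrom]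
  refine le_iInf₂ ?_
  rintro _ ⟨hx, f, g, rfl⟩
  obtain ⟨h1, h2⟩ := hx
  rw [le_principal_iff]
  have h3 : ∃ c : k, c ≠ 0 ∧
      ∀ᶠ x : Spa A (powerBounded A) in F, x.val (algebraMap k A c) < x.val g := by
    rw [ne_eq, ← le_zero_iff, ← map_zero (ultrafilterLim k F).val, val_ultrafilterLim_le_iff] at h2
    push Not at h2
    obtain ⟨-, c, hc, h⟩ := h2
    exact ⟨c, hc, h⟩
  obtain ⟨c, hc, h3⟩ := h3
  rcases (val_ultrafilterLim_le_iff k F f g).1 h1 with h | h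
  · filter_upwards [h, h3] with x hx h3
    exact ⟨hx, ne_zero_of_lt h3⟩
  · filter_upwards [h c hc, h3] with x hx h3
    exact ⟨hx.trans h3.le, ne_zero_of_lt h3⟩

variable (k) [IsUltrametricDist k]

theorem surjective_toBerkovich :
    Function.Surjective (toBerkovich k : Spa A (powerBounded A) → BerkovichSpectrum A) :=
  fun p => ⟨p.toSpa k, p.toBerkovich_toSpa k⟩

theorem isQuotientMap_toBerkovich :
    IsQuotientMap (toBerkovich k : Spa A (powerBounded A) → BerkovichSpectrum A) := by
  have := compactSpace (A := A) k
  exact (continuous_toBerkovich k).isClosedMap.isQuotientMap (continuous_toBerkovich k)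
    (surjective_toBerkovich k)

theorem existsUnique_continuous_factor {Y : Type*} [TopologicalSpace Y] [T1Space Y]
    {f : Spa A (powerBounded A) → Y} (hf : Continuous f) :
    ∃! g : BerkovichSpectrum A → Y, Continuous g ∧ f = g ∘ toBerkovich k := by
  -- The factor is `f` on the section `toSpa`; its continuity comes from the quotient topology, not
  -- from the section.
  have h : f = (fun p : BerkovichSpectrum A => f (p.toSpa k)) ∘ toBerkovich k := by
    funext x
    exact (((x.toSpa_toBerkovich_specializes k).map hf).eq).symm
  refine ⟨_, ⟨?_, h⟩, fun g hg => ?_⟩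
  · rw [(isQuotientMap_toBerkovich k).continuous_iff, ← h]
    exact hf
  · exact (surjective_toBerkovich k).injective_comp_right (hg.2.symm.trans h)

end Spa

end

theorem mainTheorem4 {k : Type*} [NontriviallyNormedField k] [IsUltrametricDist k]
    [CompleteSpace k] {A : Type*} [NormedCommRing A] [NormedAlgebra k A] [CompleteSpace A]
    (hA : IsStrictlyAffinoid k A) :
    -- every point has a unique maximal generization, and this generization has rank one
    (∀ x : Spa A (powerBounded A), ∃! η, IsMaximalGenerization η x) ∧
    (∀ x η : Spa A (powerBounded A), IsMaximalGenerization η x → η.rank = 1) ∧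
    -- every rank one point is represented by a unique element of the Berkovich spectrum
    (∀ η : Spa A (powerBounded A), η.rank = 1 →
      ∃! p : BerkovichSpectrum A, p.Represents η) ∧
    -- the elements of the Berkovich spectrum are normalized
    (∀ (p : BerkovichSpectrum A) (a : k), p.seminorm (algebraMap k A a) = ‖a‖) ∧
    ∃ q : Spa A (powerBounded A) → BerkovichSpectrum A,
      -- `q x` is the representative of the maximal generization of `x`
      (∀ x η, IsMaximalGenerization η x → (q x).Represents η) ∧
      Continuous q ∧ Function.Surjective q ∧
      -- `q` is the universal quotient of the adic spectrum among `T₁`-spaces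
      Topology.IsQuotientMap q ∧ T1Space (BerkovichSpectrum A) ∧
      ∀ (Y : Type*) [TopologicalSpace Y] [T1Space Y] (f : Spa A (powerBounded A) → Y),
        Continuous f → ∃! g : BerkovichSpectrum A → Y, Continuous g ∧ f = g ∘ q := by
  refine ⟨fun x => ⟨_, (Spa.isMaximalGenerization_iff k).2 rfl,
      fun η hη => (Spa.isMaximalGenerization_iff k).1 hη⟩, fun x η hη => ?_, fun η hη => ?_,
    fun p a => p.seminorm_algebraMap a, Spa.toBerkovich k, fun x η hη => ?_,
    Spa.continuous_toBerkovich k, Spa.surjective_toBerkovich k, Spa.isQuotientMap_toBerkovich k,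
    inferInstance, fun Y _ _ f hf => Spa.existsUnique_continuous_factor k hf⟩
  · rw [(Spa.isMaximalGenerization_iff k).1 hη]
    exact (BerkovichSpectrum.represents_toSpa k _).rank_eq_one k
  · exact ⟨_, Spa.represents_toBerkovich_of_rank_eq_one k hη, fun p hp =>
      (hp.toBerkovich_eq (k := k)).symm⟩
  · rw [(Spa.isMaximalGenerization_iff k).1 hη]
    exact BerkovichSpectrum.represents_toSpa k _
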